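/- **Setting.** All manifolds carry a global coordinate and are identified with open subsets of Euclidean spaces. An RMP-tree is a finite rooted tree whose nodes carry such manifolds and whose edges $e$ from a node $u$ to a child $v$ carry smooth maps $\psi_e$ from the manifold of $u$ to the manifold of $v$, with Jacobian $J_e$. The root $r$ carries the configuration space $\mathcal C\subseteq\mathbb R^d$, with coordinate $q$; the leaves $l_1,\dots,l_K$ carry the subtask spaces $\mathcal T_k\subseteq\mathbb R^{m_k}$, with coordinates $z_k$. Let $\psi_{r\to l_k}:\mathcal C\to\mathcal T_k$ be the composition of the edge maps from the root to $l_k$, and $J_{r\to l_k}$ its Jacobian. Each leaf has a $C^1$ metric $G_k(z_k,\dot z_k)$ (symmetric positive semidefinite), a potential $\Phi_k(z_k)$ that is $C^1$ and bounded below, a force $f_k(z_k,\dot z_k)$, the inertia matrix $M_k=G_k+\Xi_{G_k}$ with $\Xi_{G}(z,\dot z)=\frac12\sum_i\dot z_i\,\partial_{\dot z}\,g_i(z,\dot z)$ ($g_i$ the $i$-th column of $G$), and the Lyapunov function candidate $V_k(z_k,\dot z_k)=\frac12\dot z_k^\top G_k\dot z_k+\Phi_k(z_k)$. For a node $u$ with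 coordinate $x$ and children $v_j$ along edges $e_j$, one sets recursively (quantities of $v_j$ being evaluated at $(\psi_{e_j}(x),J_{e_j}\dot x)$) $$M_u=\sum_jJ_{e_j}^\top M_{v_j}J_{e_j},\quad f_u=\sum_jJ_{e_j}^\top\bigl(f_{v_j}-M_{v_j}\dot J_{e_j}\dot x\bigr),\quad G_u=\sum_jJ_{e_j}^\top G_{v_j}J_{e_j},\quad \Phi_u=\sum_j\Phi_{v_j}\circ\psi_{e_j}.$$ The RMPflow closed loop is $\ddot q=M_r(q,\dot q)^{\dagger}f_r(q,\dot q)$ on the state space $\mathcal C\times\mathbb R^d$ (with $\dagger$ the Moore–Penrose inverse), and $V_r(q,\dot q)=\frac12\dot q^\top G_r(q,\dot q)\dot q+\Phi_r(q)$. It is assumed that $V_r:\mathcal C\times\mathbb R^d\to\mathbb R$ is proper and that the closed-loop control policy $M_r^{\dagger}f_r$ is locally Lipschitz. **Theorem.** Suppose that for each leaf the dynamics $f_k=M_k\ddot z_k$ renders $\dot V_k(z_k,\dot z_k)\le-\alpha_k(\|\dot z_k\|)$ at all states, where $\alpha_k$ is a class-$\mathcal K$ function (continuous and strictly increasing on $[0,\infty)$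 with $\alpha_k(0)=0$). Suppose that $M_r$ is nonsingular at every state, and that the task map $q\mapsto(\psi_{r\to l_k}(q))_{k=1}^K$ is an immersion. Then the set $$\mathcal C_\infty=\Bigl\{(q,\dot q):\ \dot q=0,\ \sum_{k=1}^KJ_{r\to l_k}^\top f_k=0\Bigr\}$$ (with $f_k$ evaluated at $(\psi_{r\to l_k}(q),J_{r\to l_k}\dot q)$) is forward invariant, and the closed loop converges to it: from every initial state there is a solution on $[0,\infty)$, and every such solution eventually enters and stays in each neighbourhood of $\mathcal C_\infty$ (in particular its distance to $\mathcal C_\infty$ tends to $0$). If, in addition, $f_k=-\nabla\Phi_k(z_k)$ whenever $\dot z_k=0$, for every leaf, then the set $$\mathcal C^\Phi_\infty=\{(q,\dot q):\ \nabla\Phi_r(q)=0,\ \dot q=0\}$$ is forward invariant and the closed loop converges to it in the same sense. -/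

import Mathlib

open Set Filter Topology
open scoped ContDiff

noncomputable section

namespace RMPflow

/-- Euclidean coordinate space of dimension `m`. A manifold with a global coordinate is represented
by the open subset of `E m` that the coordinate maps it onto. -/
abbrev E (m : ℕ) : Type := EuclideanSpace ℝ (Fin m)

/-- Class `K` functions: continuous and strictly increasing on `[0, ∞)`, vanishing at `0`. -/
def ClassK (α : ℝ → ℝ) : Prop :=
  ContinuousOn α (Ici 0) ∧ StrictMonoOn α (Ici 0) ∧ α 0 = 0

/-- The data at a leaf: the subtask manifold (in coordinates) `dom`, the metric `G (z, ż)` (matrices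
are identified with operators on Euclidean space), the potential `Φ` and the force policy
`f (z, ż)`. -/
structure LeafRMP (m : ℕ) where
  dom : Set (E m)
  G : E m → E m → (E m →L[ℝ] E m)
  Φ : E m → ℝ
  f : E m → E m → E m

namespace LeafRMP

variable {m : ℕ} (L : LeafRMP m)

/-- The curvature term `Ξ_G (z, ż) = ½ ∑ᵢ żᵢ ∂_ż gᵢ`, with `gᵢ` the `i`-th column of `G`: applied to
a vector `a` it is `½ (∂_ż G (z, ż) [a]) ż`. -/
def curvature (z v : E m) : E m →L[ℝ] E m :=
  (1 / 2 : ℝ) • (fderiv ℝ (L.G z) v).flip v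

/-- The inertia matrix `M = G + Ξ_G`. -/
def inertia (z v : E m) : E m →L[ℝ] E m :=
  L.G z v + L.curvature z v

/-- The Lyapunov function candidate `½ żᵀ G (z, ż) ż + Φ (z)`. -/
def lyapunov (z v : E m) : ℝ :=
  1 / 2 * inner ℝ v (L.G z v v) + L.Φ z

/-- The time derivative of the Lyapunov function candidate at the state `(z, v)` when the
acceleration is `a`. -/
def lyapunovRate (z v a : E m) : ℝ :=
  fderiv ℝ (fun p : E m × E m => L.lyapunov p.1 p.2) (z, v) (v, a)

/-- Standing assumptions on a leaf: the subtask manifold is open in coordinates, the metric is `C¹`,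
symmetric and positive (semi)definite, the potential is `C¹` and bounded below. -/
def WellFormed : Prop :=
  IsOpen L.dom ∧
  ContDiffOn ℝ 1 (fun p : E m × E m => L.G p.1 p.2) (L.dom ×ˢ univ) ∧
  (∀ z ∈ L.dom, ∀ v, (L.G z v).IsPositive) ∧
  ContDiffOn ℝ 1 L.Φ L.dom ∧
  BddBelow (L.Φ '' L.dom)

/-- The leaf dynamics `M z̈ = f` renders `V̇ ≤ -α (‖ż‖)`: at every state, accelerations with
`M z̈ = f` exist and all of them satisfy the decay condition. -/
def RendersDecay (α : ℝ → ℝ) : Prop :=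
  ∀ z ∈ L.dom, ∀ v : E m,
    (∃ a, L.inertia z v a = L.f z v) ∧
    ∀ a, L.inertia z v a = L.f z v → L.lyapunovRate z v a ≤ -α ‖v‖

end LeafRMP

/-- An RMP-tree whose root manifold has an `m`-dimensional coordinate. A node that is not a leaf
carries its manifold and, for each of its `N` edges, the map to the child manifold. -/
inductive RMPTree : ℕ → Type
  | leaf {m : ℕ} (L : LeafRMP m) : RMPTree m
  | node {m : ℕ} (dom : Set (E m)) (N : ℕ) (n : Fin N → ℕ)
      (ψ : ∀ j, E m → E (n j)) (child : ∀ j, RMPTree (n j)) : RMPTree m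

namespace RMPTree

/-- The manifold (in coordinates) of the root node. -/
def dom : {m : ℕ} → RMPTree m → Set (E m)
  | _, leaf L => L.dom
  | _, node U _ _ _ _ => U

/-- Standing assumptions on the tree: node manifolds are open in coordinates, edge maps are smooth
and map the parent manifold into the child manifold, and every leaf is well formed. -/
def WellFormed : {m : ℕ} → RMPTree m → Prop
  | _, leaf L => L.WellFormed
  | _, node U _ _ ψ child => IsOpen U ∧
      ∀ j, ContDiffOn ℝ ∞ (ψ j) U ∧ MapsTo (ψ j) U (child j).dom ∧ (child j).WellFormed

/-- The inertia matrix of the root node, by recursive `pullback`: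
`M_u (x, ẋ) = ∑ⱼ Jⱼᵀ M_{vⱼ} (ψⱼ x, Jⱼ ẋ) Jⱼ`. -/
def inertia : {m : ℕ} → RMPTree m → E m → E m → (E m →L[ℝ] E m)
  | _, leaf L, x, v => L.inertia x v
  | _, node _ _ _ ψ child, x, v => ∑ j,
      (fderiv ℝ (ψ j) x).adjoint ∘L
        (child j).inertia (ψ j x) (fderiv ℝ (ψ j) x v) ∘L fderiv ℝ (ψ j) x

/-- The force of the root node, by recursive `pullback`:
`f_u (x, ẋ) = ∑ⱼ Jⱼᵀ (f_{vⱼ} - M_{vⱼ} J̇ⱼ ẋ)` at the pushed forward states `(ψⱼ x, Jⱼ ẋ)`, with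
`J̇ⱼ = DJⱼ (x) [ẋ]`. -/
def force : {m : ℕ} → RMPTree m → E m → E m → E m
  | _, leaf L, x, v => L.f x v
  | _, node _ _ _ ψ child, x, v => ∑ j,
      (fderiv ℝ (ψ j) x).adjoint
        ((child j).force (ψ j x) (fderiv ℝ (ψ j) x v) -
          (child j).inertia (ψ j x) (fderiv ℝ (ψ j) x v)
            (fderiv ℝ (fun y => fderiv ℝ (ψ j) y) x v v))

/-- The metric of the root node: `G_u (x, ẋ) = ∑ⱼ Jⱼᵀ G_{vⱼ} (ψⱼ x, Jⱼ ẋ) Jⱼ`. -/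
def metric : {m : ℕ} → RMPTree m → E m → E m → (E m →L[ℝ] E m)
  | _, leaf L, x, v => L.G x v
  | _, node _ _ _ ψ child, x, v => ∑ j,
      (fderiv ℝ (ψ j) x).adjoint ∘L
        (child j).metric (ψ j x) (fderiv ℝ (ψ j) x v) ∘L fderiv ℝ (ψ j) x

/-- The potential of the root node: `Φ_u = ∑ⱼ Φ_{vⱼ} ∘ ψⱼ`. -/
def potential : {m : ℕ} → RMPTree m → E m → ℝ
  | _, leaf L, x => L.Φ x
  | _, node _ _ _ ψ child, x => ∑ j, (child j).potential (ψ j x)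

/-- The index type of the leaves. -/
def Leaf : {m : ℕ} → RMPTree m → Type
  | _, leaf _ => Unit
  | _, node _ _ _ _ child => Σ j, (child j).Leaf

/-- A tree has finitely many leaves. -/
@[reducible]
def leafFintype : {m : ℕ} → (T : RMPTree m) → Fintype T.Leaf
  | _, leaf _ => inferInstanceAs (Fintype Unit)
  | _, node _ _ _ _ child =>
      letI : ∀ j, Fintype (child j).Leaf := fun j => (child j).leafFintype
      inferInstanceAs (Fintype (Σ j, (child j).Leaf))

instance {m : ℕ} (T : RMPTree m) : Fintype T.Leaf := T.leafFintype

/-- The dimension of the subtask manifold at a leaf. -/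
def leafDim : {m : ℕ} → (T : RMPTree m) → T.Leaf → ℕ
  | m, leaf _, _ => m
  | _, node _ _ _ _ child, k => (child k.1).leafDim k.2

/-- The data at a leaf. -/
def leafRMP : {m : ℕ} → (T : RMPTree m) → (k : T.Leaf) → LeafRMP (T.leafDim k)
  | _, leaf L, _ => L
  | _, node _ _ _ _ child, k => (child k.1).leafRMP k.2

/-- The map from the root manifold to a leaf manifold: the composition of the edge maps. -/
def leafMap : {m : ℕ} → (T : RMPTree m) → (k : T.Leaf) → E m → E (T.leafDim k)
  | _, leaf _, _ => fun x => x
  | _, node _ _ _ ψ child, k => fun x => (child k.1).leafMap k.2 (ψ k.1 x)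

variable {d : ℕ} (T : RMPTree d)

/-- The Jacobian of the map from the root to a leaf. -/
def leafJac (k : T.Leaf) (q : E d) : E d →L[ℝ] E (T.leafDim k) :=
  fderiv ℝ (T.leafMap k) q

/-- The force of leaf `k` at the state `(ψ_k q, J_k v)` pushed forward from the root. -/
def leafForce (k : T.Leaf) (q v : E d) : E (T.leafDim k) :=
  (T.leafRMP k).f (T.leafMap k q) (T.leafJac k q v)

/-- The states `(q, q̇)` of the root. -/
def stateSpace : Set (E d × E d) := T.dom ×ˢ univ

/-- The Lyapunov function candidate of the root, `½ q̇ᵀ G_r (q, q̇) q̇ + Φ_r (q)`. -/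
def lyapunov (q v : E d) : ℝ :=
  1 / 2 * inner ℝ v (T.metric q v v) + T.potential q

/-- The control policy `M_r⁻¹ f_r`, by `resolve` at the root. (Where `M_r` is nonsingular, its
Moore-Penrose inverse is its inverse.) -/
def policy (q v : E d) : E d :=
  (T.inertia q v).inverse (T.force q v)

/-- The closed-loop vector field of `q̈ = policy (q, q̇)` on states `(q, q̇)`. -/
def closedLoop (x : E d × E d) : E d × E d :=
  (x.2, T.policy x.1 x.2)

/-- The solutions of the closed-loop system on `[0, ∞)`. -/
def IsTrajectory (γ : ℝ → E d × E d) : Prop :=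
  IsIntegralCurveOn γ (fun _ x => T.closedLoop x) (Ici 0) ∧ ∀ t ∈ Ici (0 : ℝ), γ t ∈ T.stateSpace

/-- `C` is forward invariant: a solution that starts in `C` stays in `C`. -/
def ForwardInvariant (C : Set (E d × E d)) : Prop :=
  ∀ γ, T.IsTrajectory γ → γ 0 ∈ C → ∀ t ∈ Ici (0 : ℝ), γ t ∈ C

/-- The closed-loop system converges to `C`: from every state there is a solution on `[0, ∞)`, and
every solution is eventually in each neighbourhood of the set `C` (so `C` is nonempty as soon as
there are states, and the distance to `C` tends to `0`). -/
def ConvergesTo (C : Set (E d × E d)) : Prop :=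
  (∀ x ∈ T.stateSpace, ∃ γ, T.IsTrajectory γ ∧ γ 0 = x) ∧
  ∀ γ, T.IsTrajectory γ → Tendsto γ atTop (𝓝ˢ C)

/-- The set `{q̇ = 0, ∑ₖ J_kᵀ f_k = 0}`. -/
def limitSet : Set (E d × E d) :=
  {x | x ∈ T.stateSpace ∧ x.2 = 0 ∧ ∑ k, (T.leafJac k x.1).adjoint (T.leafForce k x.1 x.2) = 0}

/-- The set `{∇ Φ_r (q) = 0, q̇ = 0}`. -/
def criticalSet : Set (E d × E d) :=
  {x | x ∈ T.stateSpace ∧ gradient T.potential x.1 = 0 ∧ x.2 = 0}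

/-- The task map `q ↦ (ψ_k q)_k` is an immersion: its differential is injective at each point. -/
def TaskImmersion : Prop :=
  ∀ q ∈ T.dom, Function.Injective fun (v : E d) (k : T.Leaf) => T.leafJac k q v

end RMPTree

end RMPflow

end

/-! The root Lyapunov function `V` is the sum of the leaf Lyapunov functions along the maps
`(q, v) ↦ (ψ_k q, J_k v)`. At a leaf, the curvature term in `M = G + Ξ` makes the velocity derivative
of `V_k` equal to `⟪ż, M ·⟫`, so the decay hypothesis extends to arbitrary accelerations:
`V̇_k ≤ -α_k ‖ż‖ + ⟪ż, M_k z̈ - f_k⟫` (`LeafRMP.RendersDecay.lyapunovRate_le`). Pulling forces back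
through the tree with the correction `-M J̇ ẋ` is exactly what makes the power `⟪q̇, M_r q̈ - f_r⟫` of
the root residual the sum of the leaf powers (`RMPTree.WellFormed.inner_residual_eq_sum`). It is zero
on the closed loop, whence `V̇ ≤ -∑ α_k ‖J_k q̇‖`
(`RMPTree.WellFormed.fderiv_lyapunov_closedLoop_le`).

Properness of `V`, with a lower bound on `V` from the leaf potentials, makes its sublevel sets
compact. Solutions cannot leave them, so they exist for all times
(`exists_isIntegralCurveOn_Ici`), and LaSalle's principle applies (`tendsto_nhdsSet_of_lyapunov`): at
a limit point starts a solution along which `V` is constant. Along it `J_k q̇ = 0` for all `k`, so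
`q̇ = 0` by the immersion hypothesis, hence `q̈ = 0`, and the root force, which at rest is
`∑ J_kᵀ f_k`, vanishes. Conversely the points of the limit set are equilibria, so forward invariance
is uniqueness of solutions. When `f_k = -∇Φ_k` at rest, `∑ J_kᵀ f_k = -∇Φ_r`, and the two sets
coincide. -/

/-! ### Flows of locally Lipschitz vector fields with a proper Lyapunov function -/

namespace RMPflow

section Lyapunov

variable {X : Type*} [NormedAddCommGroup X] [NormedSpace ℝ X]

/-- A bounded Lipschitz map into a finite-dimensional space extends to a bounded Lipschitz map:
extend each coordinate and clamp it. -/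
theorem exists_bounded_lipschitz_extension [FiniteDimensional ℝ X] {Y : Type*}
    [PseudoMetricSpace Y] {s : Set Y} {f : Y → X} {K : NNReal} (hf : LipschitzOnWith K f s)
    (hb : Bornology.IsBounded (f '' s)) :
    ∃ (g : Y → X) (K' B : NNReal), LipschitzWith K' g ∧ (∀ y, ‖g y‖ ≤ B) ∧ EqOn g f s := by
  obtain ⟨C, hC⟩ := hb.exists_norm_le
  let A := (Module.finBasis ℝ X).equivFun.toContinuousLinearEquiv
  obtain ⟨g, hg, hgs⟩ := (A.lipschitz.comp_lipschitzOnWith hf).extend_pi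
  set D : ℝ := ‖A.toContinuousLinearMap‖ * max C 0 with hD
  have hD0 : 0 ≤ D := by positivity
  have hDD : -D ≤ D := by linarith
  let c : ℝ → ℝ := fun r => projIcc (-D) D hDD r
  have hc : LipschitzWith 1 c := by
    have := (LipschitzWith.subtype_val (Icc (-D) D)).comp (LipschitzWith.projIcc hDD)
    simpa [c, Function.comp_def] using this
  let h : Y → Fin (Module.finrank ℝ X) → ℝ := fun y i => c (g y i)
  have hh : LipschitzWith (‖A.toContinuousLinearMap‖₊ * K) h := by
    refine LipschitzWith.of_dist_le_mul fun x y => ?_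
    refine (dist_pi_le_iff (by positivity)).2 fun i => ?_
    calc dist (c (g x i)) (c (g y i)) ≤ 1 * dist (g x i) (g y i) := hc.dist_le_mul _ _
      _ ≤ dist (g x) (g y) := by rw [one_mul]; exact dist_le_pi_dist _ _ i
      _ ≤ _ := hg.dist_le_mul _ _
  have hhD : ∀ y, ‖h y‖ ≤ D := fun y =>
    (pi_norm_le_iff_of_nonneg hD0).2 fun i => by
      have := (projIcc (-D) D hDD (g y i)).2
      exact abs_le.2 this
  refine ⟨A.symm ∘ h, _, ‖A.symm.toContinuousLinearMap‖₊ * ⟨D, hD0⟩,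
    A.symm.lipschitz.comp hh, fun y => ?_, fun y hy => ?_⟩
  · calc ‖A.symm (h y)‖ ≤ ‖A.symm.toContinuousLinearMap‖ * ‖h y‖ :=
          A.symm.toContinuousLinearMap.le_opNorm _
      _ ≤ _ := by
        exact mul_le_mul_of_nonneg_left (hhD y) (norm_nonneg _)
  · have h1 : h y = A (f y) := by
      have h2 : g y = A (f y) := (hgs hy).symm
      have h3 : ‖A (f y)‖ ≤ D :=
        (A.toContinuousLinearMap.le_opNorm _).trans (mul_le_mul_of_nonneg_left
          ((hC _ ⟨y, hy, rfl⟩).trans (le_max_left _ _)) (norm_nonneg _))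
      funext i
      have h4 : A (f y) i ∈ Icc (-D) D := abs_le.1 ((norm_le_pi_norm _ i).trans h3)
      simp only [h, c, h2]
      rw [projIcc_of_mem hDD h4]
    simp [h1]

/-- A bounded, globally Lipschitz vector field has solutions on every time interval `[0, b]`. -/
theorem exists_isIntegralCurveOn_Icc_of_lipschitzWith [CompleteSpace X] {F : X → X}
    {K B : NNReal} (hF : LipschitzWith K F) (hB : ∀ x, ‖F x‖ ≤ B) (x : X) {b : ℝ} (hb : 0 ≤ b) :
    ∃ γ : ℝ → X, γ 0 = x ∧ IsIntegralCurveOn γ (fun _ => F) (Icc 0 b) := by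
  have h : IsPicardLindelof (fun _ => F) (⟨0, le_rfl, hb⟩ : Icc 0 b) x (B * b.toNNReal) 0 B K :=
    IsPicardLindelof.of_time_independent (fun y _ => hB y) hF.lipschitzOnWith (by simp [hb])
  exact h.exists_eq_forall_mem_Icc_hasDerivWithinAt₀

/-- Solutions of a vector field that is locally Lipschitz on `S` and that stay in `S` are determined
by their initial value: the field is Lipschitz on the compact union of the two images. -/
theorem eqOn_of_locallyLipschitzOn {F : X → X} {S : Set X} (hF : LocallyLipschitzOn S F)
    {γ δ : ℝ → X} {b : ℝ}
    (hγ : IsIntegralCurveOn γ (fun _ => F) (Icc 0 b)) (hγS : MapsTo γ (Icc 0 b) S)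
    (hδ : IsIntegralCurveOn δ (fun _ => F) (Icc 0 b)) (hδS : MapsTo δ (Icc 0 b) S)
    (h0 : γ 0 = δ 0) : EqOn γ δ (Icc 0 b) := by
  have hK : IsCompact (γ '' Icc 0 b ∪ δ '' Icc 0 b) :=
    (isCompact_Icc.image_of_continuousOn hγ.continuousOn).union
      (isCompact_Icc.image_of_continuousOn hδ.continuousOn)
  obtain ⟨K, hK⟩ := (hF.mono (union_subset hγS.image_subset
    hδS.image_subset)).exists_lipschitzOnWith_of_compact hK
  refine ODE_solution_unique_of_mem_Icc_right (v := fun _ => F)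
    (s := fun _ => γ '' Icc 0 b ∪ δ '' Icc 0 b) (fun _ _ => hK)
    hγ.continuousOn (fun t ht => ?_) (fun t ht => Or.inl ⟨t, Ico_subset_Icc_self ht, rfl⟩)
    hδ.continuousOn (fun t ht => ?_) (fun t ht => Or.inr ⟨t, Ico_subset_Icc_self ht, rfl⟩) h0
  · exact (hγ t (Ico_subset_Icc_self ht)).mono_of_mem_nhdsWithin (Icc_mem_nhdsGE_of_mem ht)
  · exact (hδ t (Ico_subset_Icc_self ht)).mono_of_mem_nhdsWithin (Icc_mem_nhdsGE_of_mem ht)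

/-- A solution that starts at an equilibrium stays there. -/
theorem eq_of_equilibrium {F : X → X} {S : Set X} (hF : LocallyLipschitzOn S F) {γ : ℝ → X}
    (hγ : IsIntegralCurveOn γ (fun _ => F) (Ici 0)) (hγS : MapsTo γ (Ici 0) S)
    (h0 : F (γ 0) = 0) {t : ℝ} (ht : 0 ≤ t) : γ t = γ 0 := by
  refine eqOn_of_locallyLipschitzOn hF (δ := fun _ => γ 0) (hγ.mono Icc_subset_Ici_self)
    (hγS.mono_left Icc_subset_Ici_self) (fun s _ => ?_) (fun _ _ => hγS self_mem_Ici) rfl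
    ⟨ht, le_rfl⟩
  simpa [h0] using hasDerivWithinAt_const s (Icc 0 t) (γ 0)

/-- A function whose derivative along the vector field is nonpositive does not increase along
solutions. -/
theorem antitoneOn_comp_isIntegralCurveOn {F : X → X} {S : Set X} (hS : IsOpen S) {V : X → ℝ}
    (hV : DifferentiableOn ℝ V S) (hVF : ∀ x ∈ S, fderiv ℝ V x (F x) ≤ 0) {γ : ℝ → X} {D : Set ℝ}
    (hD : Convex ℝ D) (hγ : IsIntegralCurveOn γ (fun _ => F) D) (hγS : MapsTo γ D S) :
    AntitoneOn (V ∘ γ) D := by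
  refine antitoneOn_of_hasDerivWithinAt_nonpos hD
    (hV.continuousOn.comp hγ.continuousOn hγS) (f' := fun t => fderiv ℝ V (γ t) (F (γ t)))
    (fun t ht => ?_) (fun t ht => hVF _ (hγS (interior_subset ht)))
  have h1 : HasFDerivAt V (fderiv ℝ V (γ t)) (γ t) :=
    (hV.differentiableAt (hS.mem_nhds (hγS (interior_subset ht)))).hasFDerivAt
  exact h1.comp_hasDerivWithinAt t ((hγ t (interior_subset ht)).mono interior_subset)

variable [FiniteDimensional ℝ X] {F : X → X} {S : Set X} {V : X → ℝ}

/-- Solutions exist on each interval `[0, b]`. The field is replaced by a bounded Lipschitz field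
that agrees with it on the sublevel set `V ≤ V x + 1`, and a solution of the latter never leaves
the smaller sublevel set `V ≤ V x`, where it solves the original equation. -/
theorem exists_isIntegralCurveOn_Icc (hS : IsOpen S) (hF : LocallyLipschitzOn S F)
    (hV : DifferentiableOn ℝ V S) (hVF : ∀ x ∈ S, fderiv ℝ V x (F x) ≤ 0)
    (hcpt : ∀ c, IsCompact {x | x ∈ S ∧ V x ≤ c}) {x : X} (hx : x ∈ S) {b : ℝ} (hb : 0 ≤ b) :
    ∃ γ : ℝ → X, γ 0 = x ∧ IsIntegralCurveOn γ (fun _ => F) (Icc 0 b) ∧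
      MapsTo γ (Icc 0 b) S := by
  have : CompleteSpace X := FiniteDimensional.complete ℝ X
  have hF' : LocallyLipschitzOn {y | y ∈ S ∧ V y ≤ V x + 1} F := hF.mono fun y hy => hy.1
  obtain ⟨K, hK⟩ := hF'.exists_lipschitzOnWith_of_compact (hcpt _)
  obtain ⟨G, K', B, hG, hB, hGF⟩ := exists_bounded_lipschitz_extension hK
    ((hcpt _).image_of_continuousOn hF'.continuousOn).isBounded
  obtain ⟨γ, h0, hγ⟩ := exists_isIntegralCurveOn_Icc_of_lipschitzWith hG hB x hb
  have key : Icc 0 b ⊆ {t | γ t ∈ S ∧ V (γ t) ≤ V x} := by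
    refine IsClosed.Icc_subset_of_forall_mem_nhdsWithin ?_ (by simp [h0, hx]) ?_
    · have := hγ.continuousOn.preimage_isClosed_of_isClosed isClosed_Icc (hcpt (V x)).isClosed
      rwa [inter_comm] at this
    · rintro t ⟨⟨htS, htV⟩, ht⟩
      have hnear : ∀ᶠ y in 𝓝 (γ t), y ∈ S ∧ V y ≤ V x + 1 := by
        refine Filter.Eventually.and (hS.mem_nhds htS) ?_
        have h1 : ContinuousAt V (γ t) := hV.continuousOn.continuousAt (hS.mem_nhds htS)
        exact (h1.eventually_lt continuousAt_const (by linarith : V (γ t) < V x + 1)).mono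
          fun y hy => hy.le
      have h2 : ∀ᶠ s in 𝓝[≥] t, γ s ∈ S ∧ V (γ s) ≤ V x + 1 :=
        ((hγ t (Ico_subset_Icc_self ht)).continuousWithinAt.mono_of_mem_nhdsWithin
          (Icc_mem_nhdsGE_of_mem ht)).eventually hnear
      obtain ⟨u, hu, hus⟩ := (mem_nhdsGE_iff_exists_mem_Ioc_Ico_subset ht.2).1 h2
      have hsub : Ico t u ⊆ Icc 0 b := fun s hs => ⟨ht.1.trans hs.1, hs.2.le.trans hu.2⟩
      have hanti := antitoneOn_comp_isIntegralCurveOn hS hV hVF (γ := γ) (convex_Ico t u)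
        (fun s hs => by
          have := (hγ s (hsub hs)).mono hsub
          simp only [hGF (hus hs)] at this
          exact this) (fun s hs => (hus hs).1)
      refine mem_of_superset (Ioo_mem_nhdsGT hu.1) fun s hs => ⟨(hus ⟨hs.1.le, hs.2⟩).1, ?_⟩
      exact (hanti ⟨le_rfl, hu.1⟩ ⟨hs.1.le, hs.2⟩ hs.1.le).trans htV
  refine ⟨γ, h0, fun t ht => ?_, fun t ht => (key ht).1⟩
  have h1 := hγ t ht
  simp only [hGF (x := γ t) ⟨(key ht).1, (key ht).2.trans (by linarith)⟩] at h1
  exact h1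

/-- A locally Lipschitz field with a nonincreasing Lyapunov function that has compact sublevel sets
is forward complete. -/
theorem exists_isIntegralCurveOn_Ici (hS : IsOpen S) (hF : LocallyLipschitzOn S F)
    (hV : DifferentiableOn ℝ V S) (hVF : ∀ x ∈ S, fderiv ℝ V x (F x) ≤ 0)
    (hcpt : ∀ c, IsCompact {x | x ∈ S ∧ V x ≤ c}) {x : X} (hx : x ∈ S) :
    ∃ γ : ℝ → X, γ 0 = x ∧ IsIntegralCurveOn γ (fun _ => F) (Ici 0) ∧ MapsTo γ (Ici 0) S := by
  have hex : ∀ n : ℕ, ∃ γ : ℝ → X, γ 0 = x ∧ IsIntegralCurveOn γ (fun _ => F) (Icc 0 n) ∧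
      MapsTo γ (Icc 0 n) S := fun n =>
    exists_isIntegralCurveOn_Icc hS hF hV hVF hcpt hx n.cast_nonneg
  choose γ h0 hγ hγS using hex
  have hagree : ∀ {m n : ℕ}, m ≤ n → EqOn (γ m) (γ n) (Icc 0 m) := fun {m n} hmn => by
    have hsub : Icc (0 : ℝ) m ⊆ Icc 0 n := Icc_subset_Icc_right (by exact_mod_cast hmn)
    exact eqOn_of_locallyLipschitzOn hF (hγ m) (hγS m) ((hγ n).mono hsub) ((hγS n).mono_left hsub)
      ((h0 m).trans (h0 n).symm)
  -- the solutions on `[0, n]` agree where they overlap and so fit together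
  let δ : ℝ → X := fun t => γ (⌊t⌋₊ + 1) t
  have hδ : ∀ n : ℕ, EqOn δ (γ n) (Ico 0 n) := fun n t ht => by
    have h1 : ⌊t⌋₊ + 1 ≤ n := (Nat.floor_lt ht.1).2 ht.2
    exact hagree h1 ⟨ht.1, by push_cast; exact (Nat.lt_floor_add_one t).le⟩
  refine ⟨δ, by simpa [δ] using h0 1, fun t ht => ?_, fun t ht => ?_⟩
  · obtain ⟨n, hn⟩ := exists_nat_gt t
    have hmem : Ico (0 : ℝ) n ∈ 𝓝[Ici 0] t :=
      mem_nhdsWithin.2 ⟨Iio n, isOpen_Iio, hn, fun s hs => ⟨hs.2, hs.1⟩⟩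
    have h1 : HasDerivWithinAt (γ n) (F (γ n t)) (Ici 0) t :=
      (hγ n t ⟨ht, hn.le⟩).mono_of_mem_nhdsWithin (mem_of_superset hmem Ico_subset_Icc_self)
    rw [← hδ n ⟨ht, hn⟩] at h1
    exact h1.congr_of_eventuallyEq (mem_of_superset hmem (hδ n)) (hδ n ⟨ht, hn⟩)
  · obtain ⟨n, hn⟩ := exists_nat_gt t
    rw [hδ n ⟨ht, hn⟩]
    exact hγS n ⟨ht, hn.le⟩

/-- **LaSalle's invariance principle.** If `V` has compact sublevel sets and does not increase along
the field, and `C` contains the initial value of each solution along which the derivative of `V`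
vanishes, then all solutions converge to `C`. -/
theorem tendsto_nhdsSet_of_lyapunov (hS : IsOpen S) (hF : LocallyLipschitzOn S F)
    (hV : DifferentiableOn ℝ V S) (hVF : ∀ x ∈ S, fderiv ℝ V x (F x) ≤ 0)
    (hcpt : ∀ c, IsCompact {x | x ∈ S ∧ V x ≤ c}) {C : Set X}
    (hC : ∀ φ : ℝ → X, IsIntegralCurveOn φ (fun _ => F) (Ici 0) → MapsTo φ (Ici 0) S →
      (∀ t ∈ Ici (0 : ℝ), fderiv ℝ V (φ t) (F (φ t)) = 0) → φ 0 ∈ C)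
    {γ : ℝ → X} (hγ : IsIntegralCurveOn γ (fun _ => F) (Ici 0)) (hγS : MapsTo γ (Ici 0) S) :
    Tendsto γ atTop (𝓝ˢ C) := by
  have hanti := antitoneOn_comp_isIntegralCurveOn hS hV hVF (convex_Ici 0) hγ hγS
  set K : Set X := {x | x ∈ S ∧ V x ≤ V (γ 0)} with hKdef
  have hK : IsCompact K := hcpt _
  have hγK : ∀ t, 0 ≤ t → γ t ∈ K := fun t ht => ⟨hγS ht, hanti self_mem_Ici ht ht⟩
  obtain ⟨l, hl⟩ : ∃ l, Tendsto (V ∘ γ) atTop (𝓝 l) := by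
    have hmono : Antitone fun t => V (γ (max t 0)) := fun s t hst =>
      hanti (le_max_right s 0) (le_max_right t 0) (max_le_max_right 0 hst)
    have hbdd : BddBelow (range fun t => V (γ (max t 0))) := by
      refine (hK.bddBelow_image (hV.continuousOn.mono fun x hx => hx.1)).mono ?_
      rintro _ ⟨t, rfl⟩
      exact ⟨_, hγK _ (le_max_right t 0), rfl⟩
    refine ⟨_, (tendsto_atTop_ciInf hmono hbdd).congr' ?_⟩
    filter_upwards [eventually_ge_atTop 0] with t ht
    simp [max_eq_left ht]
  refine (hasBasis_nhdsSet C).tendsto_right_iff.2 fun O ⟨hO, hCO⟩ => ?_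
  by_contra hnot
  obtain ⟨τ, hτ, hτO⟩ := exists_seq_forall_of_frequently
    ((not_eventually.1 hnot).and_eventually (eventually_ge_atTop 0))
  obtain ⟨p, ⟨hpK, hpO⟩, σ, hσ, hp⟩ := (hK.diff hO).tendsto_subseq
    (x := fun n => γ (τ n)) fun n => ⟨hγK _ (hτO n).2, (hτO n).1⟩
  obtain ⟨φ, hφ0, hφ, hφS⟩ := exists_isIntegralCurveOn_Ici hS hF hV hVF hcpt hpK.1
  have hφanti := antitoneOn_comp_isIntegralCurveOn hS hV hVF (convex_Ici 0) hφ hφS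
  have hφK : ∀ t, 0 ≤ t → φ t ∈ K := fun t ht =>
    ⟨hφS ht, (hφanti self_mem_Ici ht ht).trans (by simpa [hφ0] using hpK.2)⟩
  obtain ⟨L, hL⟩ :=
    (hF.mono fun x hx => hx.1 : LocallyLipschitzOn K F).exists_lipschitzOnWith_of_compact hK
  -- by Grönwall's inequality the shifted solutions `γ (τₙ + s)` converge to the solution from `p`
  have hshift : ∀ s, 0 ≤ s → Tendsto (fun n => γ (τ (σ n) + s)) atTop (𝓝 (φ s)) := fun s hs => by
    have hbound : ∀ n, dist (γ (τ (σ n) + s)) (φ s) ≤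
        dist (γ (τ (σ n))) p * Real.exp (L * (s - 0)) := fun n => by
      have hn : 0 ≤ τ (σ n) := (hτO _).2
      have hder : ∀ u, 0 ≤ u → HasDerivWithinAt (fun u => γ (τ (σ n) + u))
          (F (γ (τ (σ n) + u))) (Ici u) u := fun u hu => by
        have h1 := (hγ (τ (σ n) + u) (add_nonneg hn hu)).mono
          (Ici_subset_Ici.2 (add_nonneg hn hu))
        have h2 : HasDerivWithinAt (fun u => τ (σ n) + u) 1 (Ici u) u :=
          ((hasDerivAt_id u).const_add _).hasDerivWithinAt
        simpa [Function.comp_def] using h1.scomp u h2 fun w hw => add_le_add_right (mem_Ici.1 hw) _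
      have hcont : ContinuousOn (fun u => γ (τ (σ n) + u)) (Icc 0 s) :=
        hγ.continuousOn.comp (by fun_prop) fun u hu => add_nonneg hn hu.1
      refine dist_le_of_trajectories_ODE_of_mem (v := fun _ => F) (s := fun _ => K)
        (f := fun u => γ (τ (σ n) + u)) (fun _ _ => hL) hcont (fun u hu => hder u hu.1)
        (fun u hu => hγK _ (add_nonneg hn hu.1)) (hφ.continuousOn.mono Icc_subset_Ici_self)
        (fun u hu => (hφ u hu.1).mono (Ici_subset_Ici.2 hu.1)) (fun u hu => hφK u hu.1)
        (by simp [hφ0]) s ⟨hs, le_rfl⟩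
    refine tendsto_iff_dist_tendsto_zero.2 (squeeze_zero (fun _ => dist_nonneg) hbound ?_)
    simpa using (tendsto_iff_dist_tendsto_zero.1 hp).mul_const (Real.exp (L * (s - 0)))
  have hconst : ∀ s, 0 ≤ s → V (φ s) = l := fun s hs => by
    have h1 : Tendsto (fun n => V (γ (τ (σ n) + s))) atTop (𝓝 (V (φ s))) :=
      (hV.continuousOn.continuousAt (hS.mem_nhds (hφS hs))).tendsto.comp (hshift s hs)
    exact tendsto_nhds_unique h1
      (hl.comp (tendsto_atTop_add_const_right _ s (hτ.comp hσ.tendsto_atTop)))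
  refine hpO (hCO (hφ0 ▸ hC φ hφ hφS fun t ht => ?_))
  have h1 : HasDerivWithinAt (V ∘ φ) (fderiv ℝ V (φ t) (F (φ t))) (Ici 0) t :=
    ((hV.differentiableAt (hS.mem_nhds (hφS ht))).hasFDerivAt).comp_hasDerivWithinAt t (hφ t ht)
  have h2 : HasDerivWithinAt (V ∘ φ) 0 (Ici 0) t :=
    (hasDerivWithinAt_const t (Ici 0) l).congr (fun s hs => hconst s hs) (hconst t ht)
  exact (uniqueDiffOn_Ici (0 : ℝ) t ht).eq_deriv _ h1 h2

end Lyapunov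

/-! ### Energy balance at a leaf -/

namespace LeafRMP

variable {m : ℕ} {L : LeafRMP m}

theorem WellFormed.differentiableAt_metric (hL : L.WellFormed) {z : E m} (hz : z ∈ L.dom)
    (v : E m) : DifferentiableAt ℝ (fun p : E m × E m => L.G p.1 p.2) (z, v) :=
  (hL.2.1.differentiableOn one_ne_zero).differentiableAt
    ((hL.1.prod isOpen_univ).mem_nhds ⟨hz, mem_univ v⟩)

theorem WellFormed.differentiableAt_potential (hL : L.WellFormed) {z : E m} (hz : z ∈ L.dom) :
    DifferentiableAt ℝ L.Φ z :=
  (hL.2.2.2.1.differentiableOn one_ne_zero).differentiableAt (hL.1.mem_nhds hz)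

theorem WellFormed.differentiableAt_lyapunov (hL : L.WellFormed) {z : E m} (hz : z ∈ L.dom)
    (v : E m) : DifferentiableAt ℝ (fun p : E m × E m => L.lyapunov p.1 p.2) (z, v) := by
  have h1 := hL.differentiableAt_metric hz v
  have h2 : DifferentiableAt ℝ (fun p : E m × E m => L.Φ p.1) (z, v) :=
    (hL.differentiableAt_potential hz).comp (z, v) differentiableAt_fst
  have h3 : DifferentiableAt ℝ (fun p : E m × E m => L.G p.1 p.2 p.2) (z, v) :=
    h1.clm_apply differentiableAt_snd
  exact ((differentiableAt_snd.inner ℝ h3).const_mul _).add h2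

/-- The velocity derivative of the Lyapunov function is `b ↦ ⟪ż, M b⟫`: this is what the curvature
term in `M = G + Ξ` is for. -/
theorem WellFormed.fderiv_lyapunov_velocity (hL : L.WellFormed) {z : E m} (hz : z ∈ L.dom)
    (v b : E m) :
    fderiv ℝ (fun p : E m × E m => L.lyapunov p.1 p.2) (z, v) (0, b) =
      inner ℝ v (L.inertia z v b) := by
  have hG : HasFDerivAt (L.G z) (fderiv ℝ (L.G z) v) v :=
    ((hL.differentiableAt_metric hz v).comp v
      ((differentiableAt_const z).prodMk differentiableAt_id)).hasFDerivAt
  have h0 : HasFDerivAt (fun w : E m => (z, w)) (ContinuousLinearMap.inr ℝ (E m) (E m)) v :=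
    hasFDerivAt_prodMk_right z v
  have h1 := (hL.differentiableAt_lyapunov hz v).hasFDerivAt.comp v h0
  have h2 : HasFDerivAt (fun w => L.lyapunov z w) _ v :=
    (((hasFDerivAt_id v).inner ℝ (hG.clm_apply (hasFDerivAt_id v))).const_mul (1 / 2 : ℝ)).add_const
      (L.Φ z)
  have h3 := congrArg (fun A => A b) (h1.unique h2)
  have hsymm : inner ℝ b (L.G z v v) = inner ℝ v (L.G z v b) := by
    rw [real_inner_comm, (hL.2.2.1 z hz v).inner_left_eq_inner_right]
  simp [fderivInnerCLM_apply, inner_add_right, hsymm] at h3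
  rw [h3]
  simp [inertia, curvature, inner_add_right, inner_smul_right]
  ring

/-- Replacing the acceleration prescribed by the leaf dynamics by an arbitrary one changes the decay
rate by the power of the residual force `M a - f`. -/
theorem RendersDecay.lyapunovRate_le (hL : L.WellFormed) {α : ℝ → ℝ} (hα : L.RendersDecay α)
    {z : E m} (hz : z ∈ L.dom) (v a : E m) :
    L.lyapunovRate z v a ≤ -α ‖v‖ + inner ℝ v (L.inertia z v a - L.f z v) := by
  obtain ⟨⟨b, hb⟩, hle⟩ := hα z hz v
  have h1 : L.lyapunovRate z v a =
      L.lyapunovRate z v b + inner ℝ v (L.inertia z v (a - b)) := by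
    rw [← hL.fderiv_lyapunov_velocity hz v (a - b), lyapunovRate, lyapunovRate, ← map_add]
    simp
  rw [h1, map_sub, hb]
  exact add_le_add_left (hle b hb) _

end LeafRMP

/-! ### Flattening an RMP-tree: root quantities as sums over the leaves -/

namespace RMPTree

section Node

variable {m : ℕ} {U : Set (E m)} {N : ℕ} {n : Fin N → ℕ} {ψ : ∀ j, E m → E (n j)}
  {child : ∀ j, RMPTree (n j)}

theorem sum_leaf_node {M : Type*} [AddCommMonoid M] (g : (node U N n ψ child).Leaf → M) :
    ∑ k, g k = ∑ j, ∑ k : (child j).Leaf, g ⟨j, k⟩ :=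
  Fintype.sum_sigma (fun k : Σ j, (child j).Leaf => g k)

theorem sum_leaf_leaf {M : Type*} [AddCommMonoid M] {L : LeafRMP m} (g : (leaf L).Leaf → M) :
    ∑ k, g k = g () :=
  Fintype.sum_unique (fun k : Unit => g k)

end Node

variable {d : ℕ} {T : RMPTree d}

theorem WellFormed.isOpen_dom (hT : T.WellFormed) : IsOpen T.dom := by
  cases T with
  | leaf L => exact hT.1
  | node U N n ψ child => exact hT.1

theorem WellFormed.leafRMP_wellFormed (hT : T.WellFormed) (k : T.Leaf) :
    (T.leafRMP k).WellFormed := by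
  induction T with
  | leaf L => exact hT
  | node U N n ψ child ih => exact ih k.1 (hT.2 k.1).2.2 k.2

theorem WellFormed.mapsTo_leafMap (hT : T.WellFormed) (k : T.Leaf) :
    MapsTo (T.leafMap k) T.dom (T.leafRMP k).dom := by
  induction T with
  | leaf L => exact fun x hx => hx
  | node U N n ψ child ih =>
    exact (ih k.1 (hT.2 k.1).2.2 k.2).comp (hT.2 k.1).2.1

theorem WellFormed.contDiffOn_leafMap (hT : T.WellFormed) (k : T.Leaf) :
    ContDiffOn ℝ ∞ (T.leafMap k) T.dom := by
  induction T with
  | leaf L => exact contDiffOn_id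
  | node U N n ψ child ih =>
    exact (ih k.1 (hT.2 k.1).2.2 k.2).comp (hT.2 k.1).1 (hT.2 k.1).2.1

theorem WellFormed.differentiableAt_leafMap (hT : T.WellFormed) (k : T.Leaf) {q : E d}
    (hq : q ∈ T.dom) : DifferentiableAt ℝ (T.leafMap k) q :=
  ((hT.contDiffOn_leafMap k).differentiableOn (by simp)).differentiableAt
    (hT.isOpen_dom.mem_nhds hq)

theorem WellFormed.differentiableAt_leafJac (hT : T.WellFormed) (k : T.Leaf) {q : E d}
    (hq : q ∈ T.dom) : DifferentiableAt ℝ (T.leafJac k) q :=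
  (((hT.contDiffOn_leafMap k).fderiv_of_isOpen hT.isOpen_dom (m := 1) (by norm_cast)
    ).differentiableOn one_ne_zero).differentiableAt (hT.isOpen_dom.mem_nhds hq)

/-- The acceleration of leaf `k` at the root state `(q, v)` when the root acceleration is `a`:
`z̈ = J a + J̇ v`. -/
noncomputable def leafAccel {d : ℕ} (T : RMPTree d) (k : T.Leaf) (q v a : E d) :
    E (T.leafDim k) :=
  T.leafJac k q a + fderiv ℝ (T.leafJac k) q v v

section Node

variable {m : ℕ} {U : Set (E m)} {N : ℕ} {n : Fin N → ℕ} {ψ : ∀ j, E m → E (n j)}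
  {child : ∀ j, RMPTree (n j)}

theorem leafJac_node (hT : (node U N n ψ child).WellFormed) (j : Fin N) (k : (child j).Leaf)
    {x : E m} (hx : x ∈ U) :
    (node U N n ψ child).leafJac ⟨j, k⟩ x =
      (child j).leafJac k (ψ j x) ∘L fderiv ℝ (ψ j) x := by
  obtain ⟨hU, hj⟩ := hT
  exact fderiv_comp x ((hj j).2.2.differentiableAt_leafMap k ((hj j).2.1 hx))
    (((hj j).1.differentiableOn (by simp)).differentiableAt (hU.mem_nhds hx))

/-- The second-order chain rule, in terms of accelerations. -/
theorem leafAccel_node (hT : (node U N n ψ child).WellFormed) (j : Fin N) (k : (child j).Leaf)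
    {x : E m} (hx : x ∈ U) (v a : E m) :
    (node U N n ψ child).leafAccel ⟨j, k⟩ x v a =
      (child j).leafAccel k (ψ j x) (fderiv ℝ (ψ j) x v)
        (fderiv ℝ (ψ j) x a + fderiv ℝ (fun y => fderiv ℝ (ψ j) y) x v v) := by
  have hU : IsOpen U := hT.1
  have hj := hT.2 j
  have h1 : HasFDerivAt (ψ j) (fderiv ℝ (ψ j) x) x :=
    ((hj.1.differentiableOn (by simp)).differentiableAt (hU.mem_nhds hx)).hasFDerivAt
  have h2 : HasFDerivAt (fun y => fderiv ℝ (ψ j) y) (fderiv ℝ (fun y => fderiv ℝ (ψ j) y) x) x :=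
    (((hj.1.fderiv_of_isOpen hU (m := 1) (by norm_cast)).differentiableOn
      one_ne_zero).differentiableAt (hU.mem_nhds hx)).hasFDerivAt
  have h3 := ((hj.2.2.differentiableAt_leafJac k (hj.2.1 hx)).hasFDerivAt.comp x h1).clm_comp h2
  have h4 : (node U N n ψ child).leafJac ⟨j, k⟩ =ᶠ[𝓝 x]
      fun y => (child j).leafJac k (ψ j y) ∘L fderiv ℝ (ψ j) y := by
    filter_upwards [hU.mem_nhds hx] with y hy using leafJac_node hT j k hy
  have h5 := (h3.congr_of_eventuallyEq h4).fderiv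
  have h6 := congrArg (fun A => A v v) h5
  have h7 := congrArg (fun A => A a) (leafJac_node hT j k hx)
  unfold leafAccel
  refine (congrArg₂ (fun a b : E ((child j).leafDim k) => a + b) h7 h6).trans ?_
  simp [add_assoc]
  rfl

end Node

/-- The Lyapunov function candidate of the root is the sum of those of the leaves. -/
theorem WellFormed.lyapunov_eq_sum (hT : T.WellFormed) {q : E d} (hq : q ∈ T.dom) (v : E d) :
    T.lyapunov q v = ∑ k, (T.leafRMP k).lyapunov (T.leafMap k q) (T.leafJac k q v) := by
  induction T with
  | leaf L =>
    rw [sum_leaf_leaf]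
    have : (leaf L).leafJac () q = ContinuousLinearMap.id ℝ _ := fderiv_id
    change L.lyapunov q v = L.lyapunov q ((leaf L).leafJac () q v)
    rw [this]
    rfl
  | node U N n ψ child ih =>
    have h1 : (node U N n ψ child).lyapunov q v =
        ∑ j, (child j).lyapunov (ψ j q) (fderiv ℝ (ψ j) q v) := by
      simp only [lyapunov, metric, potential, _root_.sum_apply, inner_sum,
        ContinuousLinearMap.comp_apply, ContinuousLinearMap.adjoint_inner_right,
        Finset.mul_sum, Finset.sum_add_distrib]
    rw [h1, sum_leaf_node]
    refine Finset.sum_congr rfl fun j _ => ?_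
    rw [ih j (hT.2 j).2.2 ((hT.2 j).2.1 hq)]
    refine Finset.sum_congr rfl fun k _ => ?_
    have h2 := congrArg (fun A => A v) (leafJac_node hT j k hq)
    exact congrArg ((child j).leafRMP k |>.lyapunov _) h2.symm

/-- The residual `M a - f` of the root dynamics, tested against `w`, is the sum of the residuals of
the leaf dynamics tested against the images of `w`: the force terms `-M J̇ ẋ` in the pullback
account for the difference between `J a` and the acceleration of the child. -/
theorem WellFormed.inner_residual_eq_sum (hT : T.WellFormed) {q : E d} (hq : q ∈ T.dom)
    (v a w : E d) :
    inner ℝ w (T.inertia q v a - T.force q v) =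
      ∑ k, inner ℝ (T.leafJac k q w)
        ((T.leafRMP k).inertia (T.leafMap k q) (T.leafJac k q v) (T.leafAccel k q v a) -
          T.leafForce k q v) := by
  induction T with
  | leaf L =>
    rw [sum_leaf_leaf]
    have h1 : (leaf L).leafJac () = fun _ => ContinuousLinearMap.id ℝ _ := funext fun _ => fderiv_id
    have h3 : fderiv ℝ ((leaf L).leafJac ()) q = 0 := by
      rw [h1]
      exact fderiv_const_apply _
    have h2 : (leaf L).leafAccel () q v a = a :=
      (congrArg₂ (fun x y : E _ => x + y) (congrArg (fun A => A q a) h1)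
        (congrArg (fun A => A v v) h3)).trans (add_zero a)
    rw [h2]
    unfold leafForce
    rw [h1]
    rfl
  | node U N n ψ child ih =>
    rw [sum_leaf_node]
    simp only [inertia, force, _root_.sum_apply, ContinuousLinearMap.comp_apply,
      ← Finset.sum_sub_distrib, ← map_sub, inner_sum, ContinuousLinearMap.adjoint_inner_right]
    refine Finset.sum_congr rfl fun j _ => ?_
    have h0 := ih j (hT.2 j).2.2 ((hT.2 j).2.1 hq) (fderiv ℝ (ψ j) q v)
      (fderiv ℝ (ψ j) q a + fderiv ℝ (fun y => fderiv ℝ (ψ j) y) q v v) (fderiv ℝ (ψ j) q w)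
    -- regroup `M (J a + J̇ v) - f` as `M (J a) - (f - M (J̇ v))`, the form of the pullback
    rw [map_add, add_sub_assoc, ← neg_sub, ← sub_eq_add_neg] at h0
    rw [h0]
    refine Finset.sum_congr rfl fun k _ => ?_
    have h2 := fun u => congrArg (fun A => A u) (leafJac_node hT j k hq)
    have h3 := leafAccel_node hT j k hq v a
    unfold leafForce
    erw [h2 w, h2 v, h3]
    rfl

/-! ### The Lyapunov function of the closed loop -/

/-- The map of states `(q, v) ↦ (ψ_k q, J_k v)` is differentiable, and sends the tangent vector
`(v, a)` to `(J_k v, J_k a + J̇_k v)`. -/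
theorem WellFormed.exists_hasFDerivAt_leafState (hT : T.WellFormed) (k : T.Leaf) {q : E d}
    (hq : q ∈ T.dom) (v : E d) :
    ∃ D : E d × E d →L[ℝ] E (T.leafDim k) × E (T.leafDim k),
      HasFDerivAt (fun p : E d × E d => (T.leafMap k p.1, T.leafJac k p.1 p.2)) D (q, v) ∧
      ∀ a, D (v, a) = (T.leafJac k q v, T.leafAccel k q v a) := by
  have h1 : HasFDerivAt (T.leafMap k) (T.leafJac k q) q :=
    (hT.differentiableAt_leafMap k hq).hasFDerivAt
  have h2 := (hT.differentiableAt_leafJac k hq).hasFDerivAt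
  have hfst : HasFDerivAt (fun p : E d × E d => p.1) (ContinuousLinearMap.fst ℝ (E d) (E d))
    (q, v) := hasFDerivAt_fst
  have hsnd : HasFDerivAt (fun p : E d × E d => p.2) (ContinuousLinearMap.snd ℝ (E d) (E d))
    (q, v) := hasFDerivAt_snd
  exact ⟨_, (h1.comp (q, v) hfst).prodMk ((h2.comp (q, v) hfst).clm_apply hsnd), fun a => by
    simp [leafAccel]⟩

theorem WellFormed.differentiableOn_lyapunov (hT : T.WellFormed) :
    DifferentiableOn ℝ (fun x : E d × E d => T.lyapunov x.1 x.2) T.stateSpace := by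
  have h1 : DifferentiableOn ℝ (fun x : E d × E d => ∑ k, (T.leafRMP k).lyapunov
      (T.leafMap k x.1) (T.leafJac k x.1 x.2)) T.stateSpace := by
    rintro ⟨q, v⟩ ⟨hq, -⟩
    refine (DifferentiableAt.fun_sum fun k _ => ?_).differentiableWithinAt
    obtain ⟨D, hD, -⟩ := hT.exists_hasFDerivAt_leafState k hq v
    exact ((hT.leafRMP_wellFormed k).differentiableAt_lyapunov (hT.mapsTo_leafMap k hq)
      (T.leafJac k q v)).comp (q, v) hD.differentiableAt
  exact h1.congr fun x hx => hT.lyapunov_eq_sum hx.1 x.2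

theorem WellFormed.isOpen_stateSpace (hT : T.WellFormed) : IsOpen T.stateSpace :=
  hT.isOpen_dom.prod isOpen_univ

/-- The rate of the root Lyapunov function is the sum of the rates at the leaves. -/
theorem WellFormed.fderiv_lyapunov_eq_sum (hT : T.WellFormed) {q : E d} (hq : q ∈ T.dom)
    (v a : E d) :
    fderiv ℝ (fun x : E d × E d => T.lyapunov x.1 x.2) (q, v) (v, a) =
      ∑ k, (T.leafRMP k).lyapunovRate (T.leafMap k q) (T.leafJac k q v) (T.leafAccel k q v a) := by
  choose D hD hDa using fun k => hT.exists_hasFDerivAt_leafState k hq v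
  have h0 : ∀ k, HasFDerivAt (fun p : E (T.leafDim k) × E (T.leafDim k) =>
      (T.leafRMP k).lyapunov p.1 p.2) (fderiv ℝ (fun p : E (T.leafDim k) × E (T.leafDim k) =>
      (T.leafRMP k).lyapunov p.1 p.2) (T.leafMap k q, T.leafJac k q v))
      (T.leafMap k q, T.leafJac k q v) := fun k =>
    ((hT.leafRMP_wellFormed k).differentiableAt_lyapunov (hT.mapsTo_leafMap k hq)
      (T.leafJac k q v)).hasFDerivAt
  have h1 : HasFDerivAt (fun x : E d × E d => ∑ k, (T.leafRMP k).lyapunov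
      (T.leafMap k x.1) (T.leafJac k x.1 x.2))
      (∑ k, fderiv ℝ (fun p : E (T.leafDim k) × E (T.leafDim k) =>
        (T.leafRMP k).lyapunov p.1 p.2) (T.leafMap k q, T.leafJac k q v) ∘L D k) (q, v) :=
    HasFDerivAt.fun_sum (u := Finset.univ) fun k _ =>
      (h0 k).comp (f := fun p : E d × E d => (T.leafMap k p.1, T.leafJac k p.1 p.2)) (q, v) (hD k)
  have h2 : (fun x : E d × E d => T.lyapunov x.1 x.2) =ᶠ[𝓝 (q, v)]
      fun x => ∑ k, (T.leafRMP k).lyapunov (T.leafMap k x.1) (T.leafJac k x.1 x.2) := by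
    filter_upwards [hT.isOpen_stateSpace.mem_nhds (⟨hq, mem_univ v⟩ : (q, v) ∈ T.stateSpace)]
      with x hx using hT.lyapunov_eq_sum hx.1 x.2
  rw [(h1.congr_of_eventuallyEq h2).fderiv]
  simp only [_root_.sum_apply, ContinuousLinearMap.comp_apply, hDa, LeafRMP.lyapunovRate]

theorem inertia_policy {q v : E d} (h : IsUnit (T.inertia q v)) :
    T.inertia q v (T.policy q v) = T.force q v := by
  rw [policy, ← ContinuousLinearMap.ringInverse_eq_inverse]
  have := congrArg (fun A => A (T.force q v)) (Ring.mul_inverse_cancel _ h)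
  exact this

/-- Along the closed loop, the Lyapunov function decays at least as fast as the leaves dictate. -/
theorem WellFormed.fderiv_lyapunov_closedLoop_le (hT : T.WellFormed) {α : T.Leaf → ℝ → ℝ}
    (hdecay : ∀ k, (T.leafRMP k).RendersDecay (α k)) {x : E d × E d} (hx : x ∈ T.stateSpace)
    (hM : IsUnit (T.inertia x.1 x.2)) :
    fderiv ℝ (fun x : E d × E d => T.lyapunov x.1 x.2) x (T.closedLoop x) ≤
      -∑ k, α k ‖T.leafJac k x.1 x.2‖ := by
  obtain ⟨q, v⟩ := x
  have h1 := hT.inner_residual_eq_sum hx.1 v (T.policy q v) v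
  rw [inertia_policy hM, sub_self, inner_zero_right] at h1
  refine (hT.fderiv_lyapunov_eq_sum hx.1 v (T.policy q v)).trans_le ?_
  calc _ ≤ ∑ k, (-α k ‖T.leafJac k q v‖ + inner ℝ (T.leafJac k q v)
        ((T.leafRMP k).inertia (T.leafMap k q) (T.leafJac k q v)
          (T.leafAccel k q v (T.policy q v)) - T.leafForce k q v)) :=
        Finset.sum_le_sum fun k _ => (hdecay k).lyapunovRate_le (hT.leafRMP_wellFormed k)
          (hT.mapsTo_leafMap k hx.1) _ _
    _ = _ := by rw [Finset.sum_add_distrib, ← h1, add_zero, Finset.sum_neg_distrib]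

theorem WellFormed.exists_le_lyapunov (hT : T.WellFormed) :
    ∃ b : ℝ, ∀ x ∈ T.stateSpace, b ≤ T.lyapunov x.1 x.2 := by
  choose b hb using fun k => (hT.leafRMP_wellFormed k).2.2.2.2
  refine ⟨∑ k, b k, fun x hx => ?_⟩
  rw [hT.lyapunov_eq_sum hx.1]
  refine Finset.sum_le_sum fun k _ => ?_
  have hz := hT.mapsTo_leafMap k hx.1
  have h1 := hb k ⟨_, hz, rfl⟩
  have h2 := ((hT.leafRMP_wellFormed k).2.2.1 _ hz (T.leafJac k x.1 x.2)).inner_nonneg_right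
    (T.leafJac k x.1 x.2)
  unfold LeafRMP.lyapunov
  linarith

theorem WellFormed.isCompact_sublevel (hT : T.WellFormed)
    (hproper : IsProperMap fun x : T.stateSpace => T.lyapunov x.1.1 x.1.2) (c : ℝ) :
    IsCompact {x | x ∈ T.stateSpace ∧ T.lyapunov x.1 x.2 ≤ c} := by
  obtain ⟨b, hb⟩ := hT.exists_le_lyapunov
  convert (hproper.isCompact_preimage (isCompact_Icc (a := b) (b := c))).image
    continuous_subtype_val using 1
  ext x
  constructor
  · rintro ⟨hx, hxc⟩
    exact ⟨⟨x, hx⟩, ⟨hb x hx, hxc⟩, rfl⟩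
  · rintro ⟨y, hy, rfl⟩
    exact ⟨y.2, hy.2⟩

/-! ### Equilibria -/

/-- At zero velocity the terms `M J̇ ẋ` vanish, so the root force is the pullback of the leaf
forces. -/
theorem WellFormed.force_zero_velocity (hT : T.WellFormed) {q : E d} (hq : q ∈ T.dom) :
    T.force q 0 = ∑ k, (T.leafJac k q).adjoint (T.leafForce k q 0) := by
  refine ext_inner_left ℝ fun w => ?_
  have h1 := hT.inner_residual_eq_sum hq 0 0 w
  simpa [leafAccel, inner_sum, ContinuousLinearMap.adjoint_inner_right] using h1

theorem WellFormed.potential_eq_sum (hT : T.WellFormed) {q : E d} (hq : q ∈ T.dom) :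
    T.potential q = ∑ k, (T.leafRMP k).Φ (T.leafMap k q) := by
  simpa [lyapunov, LeafRMP.lyapunov] using hT.lyapunov_eq_sum hq 0

theorem WellFormed.gradient_potential (hT : T.WellFormed) {q : E d} (hq : q ∈ T.dom) :
    gradient T.potential q =
      ∑ k, (T.leafJac k q).adjoint (gradient (T.leafRMP k).Φ (T.leafMap k q)) := by
  refine HasGradientAt.gradient ?_
  rw [hasGradientAt_iff_hasFDerivAt]
  have h1 : HasFDerivAt (fun x => ∑ k, (T.leafRMP k).Φ (T.leafMap k x)) _ q :=
    HasFDerivAt.fun_sum (u := Finset.univ) fun k _ =>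
      ((hT.leafRMP_wellFormed k).differentiableAt_potential
        (hT.mapsTo_leafMap k hq)).hasGradientAt.hasFDerivAt.comp q
        (hT.differentiableAt_leafMap k hq).hasFDerivAt
  have h2 : T.potential =ᶠ[𝓝 q] fun x => ∑ k, (T.leafRMP k).Φ (T.leafMap k x) := by
    filter_upwards [hT.isOpen_dom.mem_nhds hq] with x hx using hT.potential_eq_sum hx
  refine (h1.congr_of_eventuallyEq h2).congr_fderiv ?_
  ext w
  simp [ContinuousLinearMap.adjoint_inner_left, leafJac]

/-- If the leaf forces at rest are the negative gradients of the potentials, then the limit set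
consists of the critical points of the root potential, at rest. -/
theorem WellFormed.limitSet_eq_criticalSet (hT : T.WellFormed)
    (hf : ∀ k, ∀ z ∈ (T.leafRMP k).dom, (T.leafRMP k).f z 0 = -gradient (T.leafRMP k).Φ z) :
    T.limitSet = T.criticalSet := by
  ext ⟨q, v⟩
  simp only [limitSet, criticalSet, mem_ofPred_eq]
  refine and_congr_right fun hx => ?_
  rw [and_comm]
  refine and_congr_left fun hv => ?_
  subst hv
  rw [hT.gradient_potential hx.1]
  have h1 : ∀ k, T.leafForce k q 0 = -gradient (T.leafRMP k).Φ (T.leafMap k q) := fun k => by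
    rw [leafForce, map_zero, hf k _ (hT.mapsTo_leafMap k hx.1)]
  simp [h1]

theorem WellFormed.closedLoop_eq_zero_of_mem_limitSet (hT : T.WellFormed) {x : E d × E d}
    (hx : x ∈ T.limitSet) : T.closedLoop x = 0 := by
  obtain ⟨q, v⟩ := x
  obtain ⟨hxS, hv, hf⟩ := hx
  dsimp only at hv hf
  subst hv
  rw [← hT.force_zero_velocity hxS.1] at hf
  simp [closedLoop, policy, hf]

/-- At rest, equilibria of the closed loop lie in the limit set. -/
theorem WellFormed.mem_limitSet_of_policy_eq_zero (hT : T.WellFormed) {x : E d × E d}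
    (hx : x ∈ T.stateSpace) (hM : IsUnit (T.inertia x.1 x.2)) (hv : x.2 = 0)
    (hp : T.policy x.1 x.2 = 0) : x ∈ T.limitSet := by
  obtain ⟨q, v⟩ := x
  dsimp only at hv hp hM
  subst hv
  have h1 := inertia_policy hM
  rw [hp, map_zero, hT.force_zero_velocity hx.1] at h1
  exact ⟨hx, rfl, h1.symm⟩

theorem eq_zero_of_sum_classK_nonpos {α : T.Leaf → ℝ → ℝ} (hα : ∀ k, ClassK (α k))
    (himm : T.TaskImmersion) {q : E d} (hq : q ∈ T.dom) {v : E d}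
    (h : ∑ k, α k ‖T.leafJac k q v‖ ≤ 0) : v = 0 := by
  have hpos : ∀ k, ∀ r : ℝ, 0 < r → 0 < α k r := fun k r hr => by
    have := (hα k).2.1 self_mem_Ici (mem_Ici.2 hr.le) hr
    rwa [(hα k).2.2] at this
  have hnonneg : ∀ k, 0 ≤ α k ‖T.leafJac k q v‖ := fun k => by
    rcases (norm_nonneg (T.leafJac k q v)).eq_or_lt with h0 | h0
    · rw [← h0, (hα k).2.2]
    · exact (hpos k _ h0).le
  have hzero := (Finset.sum_eq_zero_iff_of_nonneg fun k _ => hnonneg k).1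
    (h.antisymm (Finset.sum_nonneg fun k _ => hnonneg k))
  refine himm q hq (funext fun k => ?_)
  have h1 : ‖T.leafJac k q v‖ = 0 := by
    by_contra hne
    exact (hpos k _ ((norm_nonneg _).lt_of_ne' hne)).ne' (hzero k (Finset.mem_univ k))
  simpa using h1

theorem sum_classK_nonneg {α : T.Leaf → ℝ → ℝ} (hα : ∀ k, ClassK (α k)) (q v : E d) :
    0 ≤ ∑ k, α k ‖T.leafJac k q v‖ :=
  Finset.sum_nonneg fun k _ => by
    have := (hα k).2.1.monotoneOn self_mem_Ici (mem_Ici.2 (norm_nonneg (T.leafJac k q v)))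
      (norm_nonneg _)
    rwa [(hα k).2.2] at this

end RMPTree

end RMPflow

open RMPflow in
theorem theorem2 {d : ℕ} (T : RMPTree d) (hT : T.WellFormed)
    (hproper : IsProperMap fun x : T.stateSpace => T.lyapunov x.1.1 x.1.2)
    (hLip : LocallyLipschitzOn T.stateSpace fun x => T.policy x.1 x.2)
    (α : T.Leaf → ℝ → ℝ) (hα : ∀ k, ClassK (α k))
    (hdecay : ∀ k, (T.leafRMP k).RendersDecay (α k))
    (hM : ∀ q ∈ T.dom, ∀ v, IsUnit (T.inertia q v))
    (himm : T.TaskImmersion) :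
    (T.ForwardInvariant T.limitSet ∧ T.ConvergesTo T.limitSet) ∧
    ((∀ k, ∀ z ∈ (T.leafRMP k).dom, (T.leafRMP k).f z 0 = -gradient (T.leafRMP k).Φ z) →
      T.ForwardInvariant T.criticalSet ∧ T.ConvergesTo T.criticalSet) := by
  have hS := hT.isOpen_stateSpace
  have hF : LocallyLipschitzOn T.stateSpace T.closedLoop := fun x hx => by
    obtain ⟨K, t, ht, hK⟩ := hLip hx
    exact ⟨_, t, ht, (LipschitzWith.prod_snd.lipschitzOnWith (s := t)).prodMk hK⟩
  have hV := hT.differentiableOn_lyapunov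
  have hrate : ∀ x ∈ T.stateSpace,
      fderiv ℝ (fun x : E d × E d => T.lyapunov x.1 x.2) x (T.closedLoop x) ≤
        -∑ k, α k ‖T.leafJac k x.1 x.2‖ := fun x hx =>
    hT.fderiv_lyapunov_closedLoop_le hdecay hx (hM x.1 hx.1 x.2)
  have hVF : ∀ x ∈ T.stateSpace,
      fderiv ℝ (fun x : E d × E d => T.lyapunov x.1 x.2) x (T.closedLoop x) ≤ 0 := fun x hx =>
    (hrate x hx).trans (neg_nonpos.2 (RMPTree.sum_classK_nonneg hα x.1 x.2))
  have hcpt := hT.isCompact_sublevel hproper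
  have hmain : T.ForwardInvariant T.limitSet ∧ T.ConvergesTo T.limitSet := by
    refine ⟨fun γ hγ h0 t ht => ?_, fun x hx => ?_, fun γ hγ => ?_⟩
    · rwa [eq_of_equilibrium hF hγ.1 hγ.2 (hT.closedLoop_eq_zero_of_mem_limitSet h0) ht]
    · obtain ⟨γ, h0, hγ, hγS⟩ := exists_isIntegralCurveOn_Ici hS hF hV hVF hcpt hx
      exact ⟨γ, ⟨hγ, hγS⟩, h0⟩
    · refine tendsto_nhdsSet_of_lyapunov hS hF hV hVF hcpt (fun φ hφ hφS hφV => ?_) hγ.1 hγ.2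
      -- a solution without dissipation is at rest, so its acceleration vanishes as well
      have hrest : ∀ t ∈ Ici (0 : ℝ), (φ t).2 = 0 := fun t ht => by
        refine RMPTree.eq_zero_of_sum_classK_nonpos hα himm (hφS ht).1 ?_
        have h1 := hrate _ (hφS ht)
        rw [hφV t ht] at h1
        linarith
      have h0 : (0 : ℝ) ∈ Ici (0 : ℝ) := self_mem_Ici
      have h1 : HasDerivWithinAt (fun t => (φ t).2) (T.policy (φ 0).1 (φ 0).2) (Ici 0) 0 :=
        (hφ 0 h0).snd
      have h2 : HasDerivWithinAt (fun t => (φ t).2) 0 (Ici 0) 0 :=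
        (hasDerivWithinAt_const 0 (Ici 0) 0).congr hrest (hrest 0 h0)
      exact hT.mem_limitSet_of_policy_eq_zero (hφS h0) (hM _ (hφS h0).1 _) (hrest 0 h0)
        ((uniqueDiffOn_Ici (0 : ℝ) 0 h0).eq_deriv _ h1 h2)
  exact ⟨hmain, fun hf => hT.limitSet_eq_criticalSet hf ▸ hmain⟩
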